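/- Let $n,d\in\mathbb N$, let $V\subset\mathbb R^n$ be open, and let $\mathbb R^{d\times d}_+$ be the set of real symmetric positive definite $d\times d$ matrices. For $A\in\mathbb R^{d\times d}_+$ with spectral decomposition $A=QDQ^T$ and $\lambda\in\mathbb R$ put $A^\lambda=QD^\lambda Q^T$. Let $W^{1,\infty}_{\rm loc}(V;\mathbb R^{d\times d}_+)$ denote the set of continuous functions $A\colon V\to\mathbb R^{d\times d}_+$ whose distributional gradient $\mathcal D A=(\mathcal D_1A,\dots,\mathcal D_nA)$ is represented by a locally integrable function such that $A$ and $\mathcal D A$ are essentially bounded on every open $K$ with $\overline K$ compact and $\overline K\subset V$ (that is, the locally Lipschitz functions $V\to\mathbb R^{d\times d}_+$). For $X,Y\in\mathbb R^{n\times d\times d}$ let $\langle X,Y\rangle=\sum_{k=1}^n\sum_{i,j=1}^dX_{kij}Y_{kij}$ and $|X|=\sqrt{\langle X,X\rangle}$. **Theorem.** Let $\alpha,\beta\in\mathbb R$ and $A\in W^{1,\infty}_{\rm loc}(V;\mathbb R^{d\times d}_+)$. Then $A^\alpha$, $A^\beta$ and $A^{(\alpha+\beta)/2}$ belong to $W^{1,\infty}_{\rm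 loc}(V;\mathbb R^{d\times d}_+)$, and $$\langle\mathcal D A^\alpha,\mathcal D A^\beta\rangle\le\big|\mathcal D A^{\frac{\alpha+\beta}2}\big|^2\qquad\text{almost everywhere in }V.$$ -/

import Mathlib

open MeasureTheory

open scoped ContDiff ENNReal

/-- Matrix functions `f(A) = Q f(D) Qᵀ` for the real power `f(t) = t ^ α`, through the functional
calculus of real symmetric matrices. -/
noncomputable def matPow {d : ℕ} (A : Matrix (Fin d) (Fin d) ℝ) (α : ℝ) :
    Matrix (Fin d) (Fin d) ℝ :=
  cfc (fun t : ℝ => t ^ α) A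

/-- The Euclidean inner product on rank-3 tensors in `ℝ^{n × d × d}`. -/
def tensorInner {n d : ℕ} (X Y : Fin n → Matrix (Fin d) (Fin d) ℝ) : ℝ :=
  ∑ k, ∑ i, ∑ j, X k i j * Y k i j

/-- The Euclidean norm on rank-3 tensors in `ℝ^{n × d × d}`. -/
noncomputable def tensorNorm {n d : ℕ} (X : Fin n → Matrix (Fin d) (Fin d) ℝ) : ℝ :=
  √(tensorInner X X)

/-- `g` represents the `k`-th distributional partial derivative of `u` in the open set `V`. -/
structure IsWeakPartialDeriv {n : ℕ} (V : Set (EuclideanSpace ℝ (Fin n))) (k : Fin n)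
    (u g : EuclideanSpace ℝ (Fin n) → ℝ) : Prop where
  locallyIntegrableOn : LocallyIntegrableOn u V volume
  locallyIntegrableOn_deriv : LocallyIntegrableOn g V volume
  integral_eq : ∀ φ : EuclideanSpace ℝ (Fin n) → ℝ, ContDiff ℝ ∞ φ → HasCompactSupport φ →
    tsupport φ ⊆ V →
    ∫ x in V, u x * fderiv ℝ φ x (EuclideanSpace.single k 1) = -∫ x in V, g x * φ x

/-- `G` represents the distributional gradient `𝒟A = (𝒟₁A, …, 𝒟ₙA)` of the matrix-valued
function `A` in `V`, taken entrywise. -/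
def IsWeakGradient {n d : ℕ} (V : Set (EuclideanSpace ℝ (Fin n)))
    (A : EuclideanSpace ℝ (Fin n) → Matrix (Fin d) (Fin d) ℝ)
    (G : EuclideanSpace ℝ (Fin n) → Fin n → Matrix (Fin d) (Fin d) ℝ) : Prop :=
  ∀ k i j, IsWeakPartialDeriv V k (fun x => A x i j) (fun x => G x k i j)

/-- The class `W^{1,∞}_loc(V; ℝ^{d × d}_+)`: functions on `V` with symmetric positive definite
values that are, together with their distributional gradient, essentially bounded on every open
set compactly contained in `V`. Such a function agrees almost everywhere with a continuous one,
and is identified with it. -/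
structure MemW1InftyLocPD {n d : ℕ} (V : Set (EuclideanSpace ℝ (Fin n)))
    (A : EuclideanSpace ℝ (Fin n) → Matrix (Fin d) (Fin d) ℝ) : Prop where
  continuousOn : ContinuousOn A V
  posDef : ∀ x ∈ V, (A x).PosDef
  exists_weakGradient : ∃ G, IsWeakGradient V A G ∧
    ∀ K : Set (EuclideanSpace ℝ (Fin n)), IsOpen K → IsCompact (closure K) → closure K ⊆ V →
      (∀ i j, MemLp (fun x => A x i j) ∞ (volume.restrict K)) ∧
      ∀ k i j, MemLp (fun x => G x k i j) ∞ (volume.restrict K)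

/-! The inequality already holds for finite differences, so eigenvectors are never differentiated.
For symmetric `X`, `Y` with eigenvalues `λᵢ`, `μⱼ`, the inner product of `f(X) - f(Y)` and `g(X) -
g(Y)` is a sum of `(f(λᵢ) - f(μⱼ)) (g(λᵢ) - g(μⱼ)) cᵢⱼ`, with weights `cᵢⱼ ≥ 0` independent of `f`
and `g` (`exists_sum_cfc_sub_mul_cfc_sub_eq`). This reduces the claim to positive numbers, where it
is a perfect square (`rpow_sub_mul_rpow_sub_le`). Taking `X = A(x + t eₖ)` and `Y = A(x)`, dividing
by `t²` and letting `t → 0⁺` gives the theorem wherever the weak gradients are classical directional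
derivatives.

That is almost everywhere, because membership in the Sobolev class amounts to local Lipschitz
continuity (`locallyLipschitzOn_of_isWeakPartialDeriv` and its converse). The weighted identity also
shows that powers preserve this property (`locallyLipschitzOn_matPow`). -/

/-! ### Finite-difference inequalities for functions of two symmetric matrices. -/

theorem sum_mul_eq_sum_orthogonal_conj {d : ℕ} {U W : Matrix (Fin d) (Fin d) ℝ}
    (hU : U * star U = 1) (hW : W * star W = 1) (M N : Matrix (Fin d) (Fin d) ℝ) :
    ∑ i, ∑ j, M i j * N i j =
      ∑ i, ∑ j, (star U * M * W) i j * (star U * N * W) i j := by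
  have key : ∀ M N : Matrix (Fin d) (Fin d) ℝ,
      ∑ i, ∑ j, M i j * N i j = (star M * N).trace := by
    intro M N
    rw [Finset.sum_comm]
    simp [Matrix.trace, Matrix.mul_apply, Matrix.star_apply]
  rw [key, key]
  have h : star (star U * M * W) * (star U * N * W) =
      star W * (star M * (U * star U) * N * W) := by
    simp only [star_mul, star_star, mul_assoc]
  rw [h, hU, Matrix.trace_mul_comm (star W), mul_one, mul_assoc _ W, hW, mul_one]

/-- With eigenvector matrices `U` of `X` and `W` of `Y`, the entries of `Uᵀ (f(X) - f(Y)) W` are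
`(f(λᵢ) - f(μⱼ)) (UᵀW)ᵢⱼ`, so `c` is the entrywise square of `UᵀW`. -/
theorem exists_sum_cfc_sub_mul_cfc_sub_eq {d : ℕ} {X Y : Matrix (Fin d) (Fin d) ℝ}
    (hX : X.IsHermitian) (hY : Y.IsHermitian) :
    ∃ c : Fin d → Fin d → ℝ, (∀ i j, 0 ≤ c i j) ∧ ∀ f g : ℝ → ℝ,
      ∑ i, ∑ j, (cfc f X i j - cfc f Y i j) * (cfc g X i j - cfc g Y i j) =
        ∑ i, ∑ j, (f (hX.eigenvalues i) - f (hY.eigenvalues j)) *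
          (g (hX.eigenvalues i) - g (hY.eigenvalues j)) * c i j := by
  set U : Matrix (Fin d) (Fin d) ℝ := ↑hX.eigenvectorUnitary with hUdef
  set W : Matrix (Fin d) (Fin d) ℝ := ↑hY.eigenvectorUnitary with hWdef
  have hU : U * star U = 1 := Unitary.coe_mul_star_self _
  have hW : W * star W = 1 := Unitary.coe_mul_star_self _
  have hU' : star U * U = 1 := Unitary.coe_star_mul_self _
  have hW' : star W * W = 1 := Unitary.coe_star_mul_self _
  refine ⟨fun i j => (star U * W) i j ^ 2, fun i j => sq_nonneg _, fun f g => ?_⟩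
  have hf : ∀ f : ℝ → ℝ, ∀ i j, (star U * (cfc f X - cfc f Y) * W) i j =
      (f (hX.eigenvalues i) - f (hY.eigenvalues j)) * (star U * W) i j := by
    intro f i j
    have h : star U * (cfc f X - cfc f Y) * W =
        Matrix.diagonal (f ∘ hX.eigenvalues) * (star U * W) -
          (star U * W) * Matrix.diagonal (f ∘ hY.eigenvalues) := by
      rw [hX.cfc_eq, hY.cfc_eq, Matrix.IsHermitian.cfc, Matrix.IsHermitian.cfc,
        Unitary.conjStarAlgAut_apply, Unitary.conjStarAlgAut_apply, ← hUdef, ← hWdef,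
        mul_sub, sub_mul]
      have h1 : ∀ D : Matrix (Fin d) (Fin d) ℝ,
          star U * (U * D * star U) * W = (star U * U) * D * (star U * W) := by
        intro D; simp only [mul_assoc]
      have h2 : ∀ D : Matrix (Fin d) (Fin d) ℝ,
          star U * (W * D * star W) * W = (star U * W) * D * (star W * W) := by
        intro D; simp only [mul_assoc]
      rw [h1, h2, hU', hW', one_mul, mul_one]
      rfl
    rw [h, Matrix.sub_apply, Matrix.diagonal_mul, Matrix.mul_diagonal]
    simp only [Function.comp_apply]
    ring
  have := sum_mul_eq_sum_orthogonal_conj hU hW (cfc f X - cfc f Y) (cfc g X - cfc g Y)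
  simp only [hf, Matrix.sub_apply] at this
  rw [this]
  refine Finset.sum_congr rfl fun i _ => Finset.sum_congr rfl fun j _ => ?_
  ring

theorem rpow_sub_mul_rpow_sub_le {a b : ℝ} (ha : 0 < a) (hb : 0 < b) (α β : ℝ) :
    (a ^ α - b ^ α) * (a ^ β - b ^ β) ≤ (a ^ ((α + β) / 2) - b ^ ((α + β) / 2)) ^ 2 := by
  have hsplit : ∀ {t : ℝ}, 0 < t → ∀ γ : ℝ, t ^ γ = t ^ (γ / 2) * t ^ (γ / 2) := fun ht γ => by
    rw [← Real.rpow_add ht, add_halves]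
  have hmid : ∀ {t : ℝ}, 0 < t → t ^ ((α + β) / 2) = t ^ (α / 2) * t ^ (β / 2) := fun ht => by
    rw [← Real.rpow_add ht, add_div]
  rw [hsplit ha α, hsplit ha β, hsplit hb α, hsplit hb β, hmid ha, hmid hb]
  -- The right side minus the left side is exactly this square.
  nlinarith [sq_nonneg (a ^ (α / 2) * b ^ (β / 2) - a ^ (β / 2) * b ^ (α / 2))]

theorem sum_matPow_sub_mul_le {d : ℕ} {X Y : Matrix (Fin d) (Fin d) ℝ}
    (hX : X.PosDef) (hY : Y.PosDef) (α β : ℝ) :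
    ∑ i, ∑ j, (matPow X α i j - matPow Y α i j) * (matPow X β i j - matPow Y β i j) ≤
      ∑ i, ∑ j, (matPow X ((α + β) / 2) i j - matPow Y ((α + β) / 2) i j) ^ 2 := by
  obtain ⟨c, hc, h⟩ := exists_sum_cfc_sub_mul_cfc_sub_eq hX.isHermitian hY.isHermitian
  simp only [matPow, sq]
  rw [h, h]
  refine Finset.sum_le_sum fun i _ => Finset.sum_le_sum fun j _ =>
    mul_le_mul_of_nonneg_right ?_ (hc i j)
  rw [← sq]
  exact rpow_sub_mul_rpow_sub_le (hX.eigenvalues_pos i) (hY.eigenvalues_pos j) α β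

theorem sum_cfc_sub_sq_le {d : ℕ} {X Y : Matrix (Fin d) (Fin d) ℝ}
    (hX : X.IsHermitian) (hY : Y.IsHermitian) {s : Set ℝ} {f : ℝ → ℝ} {L : NNReal}
    (hXs : ∀ i, hX.eigenvalues i ∈ s) (hYs : ∀ i, hY.eigenvalues i ∈ s)
    (hf : LipschitzOnWith L f s) :
    ∑ i, ∑ j, (cfc f X i j - cfc f Y i j) ^ 2 ≤ L ^ 2 * ∑ i, ∑ j, (X i j - Y i j) ^ 2 := by
  obtain ⟨c, hc, h⟩ := exists_sum_cfc_sub_mul_cfc_sub_eq hX hY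
  -- The same weights express the distance of `X` and `Y` themselves, so a termwise comparison
  -- suffices.
  have hid := h id id
  rw [cfc_id ℝ X hX.isSelfAdjoint, cfc_id ℝ Y hY.isSelfAdjoint] at hid
  simp only [sq]
  rw [h, hid, Finset.mul_sum]
  refine Finset.sum_le_sum fun i _ => ?_
  rw [Finset.mul_sum]
  refine Finset.sum_le_sum fun j _ => ?_
  rw [← mul_assoc]
  refine mul_le_mul_of_nonneg_right ?_ (hc i j)
  have := hf.dist_le_mul _ (hXs i) _ (hYs j)
  rw [Real.dist_eq, Real.dist_eq] at this
  calc _ = |f (hX.eigenvalues i) - f (hY.eigenvalues j)| ^ 2 := by rw [sq_abs, sq]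
    _ ≤ (L * |hX.eigenvalues i - hY.eigenvalues j|) ^ 2 := by gcongr
    _ = _ := by rw [mul_pow, sq_abs]; simp only [id]; ring

/-! ### Spectral bounds and positivity of powers. -/

theorem Matrix.PosDef.eigenvalues_le_trace {d : ℕ} {X : Matrix (Fin d) (Fin d) ℝ}
    (hX : X.PosDef) (i : Fin d) : hX.isHermitian.eigenvalues i ≤ X.trace := by
  rw [hX.isHermitian.trace_eq_sum_eigenvalues]
  exact Finset.single_le_sum (f := fun i => hX.isHermitian.eigenvalues i)
    (fun j _ => (hX.eigenvalues_pos j).le) (Finset.mem_univ i)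

/-- Traces of `X` and `X⁻¹` depend continuously on `X`, so they confine spectra locally without
continuity of eigenvalues. -/
theorem Matrix.PosDef.inv_eigenvalues_le_trace_inv {d : ℕ} {X : Matrix (Fin d) (Fin d) ℝ}
    (hX : X.PosDef) (i : Fin d) : (hX.isHermitian.eigenvalues i)⁻¹ ≤ X⁻¹.trace := by
  have hmem := hX.isHermitian.eigenvalues_mem_spectrum_real i
  have hpos := hX.eigenvalues_pos i
  let r : ℝˣ := Units.mk0 _ hpos.ne'
  have h : ((r⁻¹ : ℝˣ) : ℝ) ∈ spectrum ℝ (((hX.isUnit.unit)⁻¹ : (Matrix (Fin d) (Fin d) ℝ)ˣ) :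
      Matrix (Fin d) (Fin d) ℝ) := by
    rw [← spectrum.inv_mem_iff]
    exact hmem
  rw [Matrix.coe_units_inv, IsUnit.unit_spec,
    hX.inv.isHermitian.spectrum_real_eq_range_eigenvalues] at h
  obtain ⟨j, hj⟩ := h
  have := hX.inv.eigenvalues_le_trace j
  rw [hj] at this
  simpa [r] using this

theorem matPow_posDef {d : ℕ} {X : Matrix (Fin d) (Fin d) ℝ} (hX : X.PosDef) (α : ℝ) :
    (matPow X α).PosDef := by
  rw [matPow, hX.isHermitian.cfc_eq, Matrix.IsHermitian.cfc, Unitary.conjStarAlgAut_apply]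
  refine Matrix.PosDef.mul_mul_conjTranspose_same (Matrix.PosDef.diagonal fun i => ?_) ?_
  · exact Real.rpow_pos_of_pos (hX.eigenvalues_pos i) α
  · intro v w hvw
    have h := congrArg (fun u => Matrix.vecMul u
      (star (hX.isHermitian.eigenvectorUnitary : Matrix (Fin d) (Fin d) ℝ))) hvw
    simpa [Matrix.vecMul_vecMul, Unitary.coe_mul_star_self] using h

theorem exists_lipschitzOnWith_rpow {a b : ℝ} (ha : 0 < a) (α : ℝ) :
    ∃ L, LipschitzOnWith L (fun t : ℝ => t ^ α) (Set.Icc a b) := by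
  refine LocallyLipschitzOn.exists_lipschitzOnWith_of_compact isCompact_Icc fun t ht => ?_
  have h : ContDiffAt ℝ 1 (fun t : ℝ => t ^ α) t :=
    Real.contDiffAt_rpow_const_of_ne (ha.trans_le ht.1).ne'
  obtain ⟨K, s, hs, hK⟩ := h.exists_lipschitzOnWith
  exact ⟨K, s, mem_nhdsWithin_of_mem_nhds hs, hK⟩

/-! ### Weak derivatives of locally Lipschitz functions. -/

theorem LocallyLipschitzOn.exists_lipschitzWith_eqOn_of_isCompact {E : Type*}
    [PseudoMetricSpace E] {V K : Set E} {u : E → ℝ} (hu : LocallyLipschitzOn V u)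
    (hK : IsCompact K) (hKV : K ⊆ V) : ∃ C w, LipschitzWith C w ∧ Set.EqOn u w K := by
  obtain ⟨C, hC⟩ := (hu.mono hKV).exists_lipschitzOnWith_of_compact hK
  exact ⟨C, hC.extend_real⟩

theorem LocallyLipschitzOn.memLp_top_lineDeriv {E : Type*} [NormedAddCommGroup E]
    [NormedSpace ℝ E] [FiniteDimensional ℝ E] [MeasurableSpace E] [BorelSpace E]
    {μ : Measure E} {V K : Set E} {u : E → ℝ}
    (hu : LocallyLipschitzOn V u) (hK : IsOpen K) (hKc : IsCompact (closure K))
    (hKV : closure K ⊆ V) (v : E) :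
    MemLp (fun x => lineDeriv ℝ u x v) ∞ (μ.restrict K) := by
  obtain ⟨C, w, hw, huw⟩ := hu.exists_lipschitzWith_eqOn_of_isCompact hKc hKV
  refine MemLp.ae_eq ?_ ((hw.memLp_lineDeriv (μ := μ) v).restrict K)
  refine (ae_restrict_iff' hK.measurableSet).2 (Filter.Eventually.of_forall fun x hx => ?_)
  refine Filter.EventuallyEq.lineDeriv_eq ?_
  filter_upwards [hK.mem_nhds hx] with y hy using (huw (subset_closure hy)).symm

theorem ContinuousOn.memLp_top_of_isCompact_closure {E : Type*} [TopologicalSpace E]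
    [MeasurableSpace E] [OpensMeasurableSpace E] {μ : Measure E} {V K : Set E} {u : E → ℝ}
    (hu : ContinuousOn u V) (hK : IsOpen K) (hKc : IsCompact (closure K)) (hKV : closure K ⊆ V) :
    MemLp u ∞ (μ.restrict K) := by
  obtain ⟨C, hC⟩ := hKc.exists_bound_of_continuousOn (hu.mono hKV)
  refine memLp_top_of_bound ?_ C ?_
  · exact (hu.mono (subset_closure.trans hKV)).aestronglyMeasurable hK.measurableSet
  · exact (ae_restrict_iff' hK.measurableSet).2
      (Filter.Eventually.of_forall fun x hx => hC x (subset_closure hx))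

theorem exists_ball_closure_subset {E : Type*} [PseudoMetricSpace E] [ProperSpace E] {V : Set E}
    (hV : IsOpen V) {x : E} (hx : x ∈ V) :
    ∃ r > 0, IsCompact (closure (Metric.ball x r)) ∧ closure (Metric.ball x r) ⊆ V := by
  obtain ⟨r, hr, h⟩ := Metric.nhds_basis_closedBall.mem_iff.1 (hV.mem_nhds hx)
  exact ⟨r, hr, (isCompact_closedBall x r).of_isClosed_subset isClosed_closure
    Metric.closure_ball_subset_closedBall, Metric.closure_ball_subset_closedBall.trans h⟩

theorem locallyIntegrableOn_of_memLp_top {E : Type*} [PseudoMetricSpace E] [ProperSpace E]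
    [MeasurableSpace E] {μ : Measure E} [IsFiniteMeasureOnCompacts μ]
    {V : Set E} (hV : IsOpen V) {g : E → ℝ}
    (hg : ∀ K : Set E, IsOpen K → IsCompact (closure K) → closure K ⊆ V →
      MemLp g ∞ (μ.restrict K)) : LocallyIntegrableOn g V μ := by
  intro x hx
  obtain ⟨r, hr, hc, hsub⟩ := exists_ball_closure_subset hV hx
  refine ⟨Metric.ball x r, mem_nhdsWithin_of_mem_nhds (Metric.ball_mem_nhds x hr), ?_⟩
  have : IsFiniteMeasure (μ.restrict (Metric.ball x r)) :=
    ⟨by simpa using (measure_mono subset_closure).trans_lt hc.measure_lt_top⟩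
  exact (hg _ Metric.isOpen_ball hc hsub).integrable le_top

theorem LocallyLipschitzOn.isWeakPartialDeriv_lineDeriv {n : ℕ}
    {V : Set (EuclideanSpace ℝ (Fin n))} (hV : IsOpen V) {u : EuclideanSpace ℝ (Fin n) → ℝ}
    (hu : LocallyLipschitzOn V u) (k : Fin n) :
    IsWeakPartialDeriv V k u (fun x => lineDeriv ℝ u x (EuclideanSpace.single k 1)) where
  locallyIntegrableOn := hu.continuousOn.locallyIntegrableOn hV.measurableSet
  locallyIntegrableOn_deriv := locallyIntegrableOn_of_memLp_top hV fun _ hK hKc hKV =>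
    hu.memLp_top_lineDeriv hK hKc hKV _
  integral_eq φ hφ hφc hφV := by
    -- The margin `δ` makes `u` and its Lipschitz extension agree near each point of the support, so
    -- that their line derivatives agree there too.
    obtain ⟨δ, hδ, hδV⟩ := hφc.isCompact.exists_cthickening_subset_open hV hφV
    obtain ⟨C, w, hw, huw⟩ := hu.exists_lipschitzWith_eqOn_of_isCompact
      (hφc.isCompact.cthickening (r := δ)) hδV
    have hev : ∀ x ∈ tsupport φ, u =ᶠ[nhds x] w := fun x hx => by
      filter_upwards [Metric.isOpen_thickening.mem_nhds
        (Metric.self_subset_thickening hδ (tsupport φ) hx)] with y hy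
      exact huw (Metric.thickening_subset_cthickening _ _ hy)
    obtain ⟨D, hD⟩ := ContDiff.lipschitzWith_of_hasCompactSupport hφc hφ (by simp)
    have key := hw.integral_lineDeriv_mul_eq (μ := volume) hD hφc (EuclideanSpace.single k 1)
    have hφ0 : ∀ x, x ∉ tsupport φ → φ x = 0 := fun x hx => image_eq_zero_of_notMem_tsupport hx
    have hDφ0 : ∀ x, x ∉ tsupport φ → fderiv ℝ φ x = 0 := fun x hx =>
      Function.notMem_support.1 fun h => hx (support_fderiv_subset ℝ h)
    have h1 : ∫ x in V, u x * fderiv ℝ φ x (EuclideanSpace.single k 1) =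
        ∫ x, w x * fderiv ℝ φ x (EuclideanSpace.single k 1) := by
      rw [setIntegral_eq_integral_of_forall_compl_eq_zero fun x hx => by
        simp [hDφ0 x fun h => hx (hφV h)]]
      congr 1 with x
      by_cases hx : x ∈ tsupport φ
      · rw [(hev x hx).eq_of_nhds]
      · simp [hDφ0 x hx]
    have h2 : ∫ x in V, lineDeriv ℝ u x (EuclideanSpace.single k 1) * φ x =
        ∫ x, lineDeriv ℝ w x (EuclideanSpace.single k 1) * φ x := by
      rw [setIntegral_eq_integral_of_forall_compl_eq_zero fun x hx => by
        simp [hφ0 x fun h => hx (hφV h)]]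
      congr 1 with x
      by_cases hx : x ∈ tsupport φ
      · rw [(hev x hx).lineDeriv_eq]
      · simp [hφ0 x hx]
    rw [h1, h2, key, ← integral_neg]
    congr 1 with x
    rw [((hφ.differentiable (by simp)) x).lineDeriv_eq_fderiv, map_neg]
    ring

theorem LocallyLipschitzOn.ae_lineDifferentiableAt {E : Type*} [NormedAddCommGroup E]
    [NormedSpace ℝ E] [FiniteDimensional ℝ E] [MeasurableSpace E] [BorelSpace E]
    {μ : Measure E} [μ.IsAddHaarMeasure] {V : Set E} (hV : IsOpen V) {u : E → ℝ}
    (hu : LocallyLipschitzOn V u) (v : E) :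
    ∀ᵐ x ∂μ, x ∈ V → LineDifferentiableAt ℝ u x v := by
  rw [ae_iff]
  refine measure_null_of_locally_null _ fun x hx => ?_
  simp only [Set.mem_ofPred_eq, Classical.not_imp] at hx
  obtain ⟨r, hr, hc, hsub⟩ := exists_ball_closure_subset hV hx.1
  obtain ⟨C, w, hw, huw⟩ := hu.exists_lipschitzWith_eqOn_of_isCompact hc hsub
  refine ⟨_, Filter.inter_mem self_mem_nhdsWithin
    (mem_nhdsWithin_of_mem_nhds (Metric.ball_mem_nhds x hr)), ?_⟩
  refine measure_mono_null ?_ (ae_iff.1 (hw.ae_lineDifferentiableAt (μ := μ) v))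
  rintro y ⟨hy, hyr⟩ hw'
  simp only [Set.mem_ofPred_eq, Classical.not_imp] at hy
  refine hy.2 (hw'.congr_of_eventuallyEq ?_)
  filter_upwards [Metric.isOpen_ball.mem_nhds hyr] with z hz using huw (subset_closure hz)

/-! ### Uniqueness of weak derivatives, and local Lipschitz continuity from bounded ones. -/

theorem IsWeakPartialDeriv.ae_eq {n : ℕ} {V : Set (EuclideanSpace ℝ (Fin n))} (hV : IsOpen V)
    {k : Fin n} {u g h : EuclideanSpace ℝ (Fin n) → ℝ} (hg : IsWeakPartialDeriv V k u g)
    (hh : IsWeakPartialDeriv V k u h) : ∀ᵐ x, x ∈ V → g x = h x := by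
  have hli := hg.locallyIntegrableOn_deriv.sub hh.locallyIntegrableOn_deriv
  have := hV.ae_eq_zero_of_integral_contDiff_smul_eq_zero hli fun φ hφ hφc hφV => ?_
  · filter_upwards [this] with x hx hxV using sub_eq_zero.1 (hx hxV)
  have hint : ∀ f, LocallyIntegrableOn f V volume →
      IntegrableOn (fun x => f x * φ x) V volume := fun f hf => by
    have h1 : IntegrableOn (fun x => f x * φ x) (tsupport φ) volume :=
      (hf.integrableOn_compact_subset hφV hφc.isCompact).mul_continuousOn
        hφ.continuous.continuousOn hφc.isCompact
    refine ((integrableOn_iff_integrable_of_support_subset fun x hx => ?_).1 h1).integrableOn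
    exact subset_tsupport φ (right_ne_zero_of_mul hx)
  have heq : ∫ x in V, g x * φ x = ∫ x in V, h x * φ x := by
    have h1 := hg.integral_eq φ hφ hφc hφV
    have h2 := hh.integral_eq φ hφ hφc hφV
    linarith
  rw [← setIntegral_eq_integral_of_forall_compl_eq_zero (s := V) fun x hx => by
    rw [image_eq_zero_of_notMem_tsupport fun h => hx (hφV h), zero_smul]]
  calc ∫ x in V, φ x • (g - h) x = ∫ x in V, (g x * φ x - h x * φ x) := by
        congr 1 with x; simp only [Pi.sub_apply, smul_eq_mul]; ring
    _ = 0 := by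
      rw [integral_sub (hint g hg.locallyIntegrableOn_deriv)
        (hint h hh.locallyIntegrableOn_deriv), heq, sub_self]

-- Testing the weak derivative with `y ↦ ρ(x - y)` shows that the derivative of the mollification is
-- an average of `g` over a ball where `|g| ≤ M`. The sign from reflecting `ρ` cancels the one from
-- integration by parts.
open scoped Convolution in
theorem IsWeakPartialDeriv.abs_fderiv_mollification_le {n : ℕ}
    {V : Set (EuclideanSpace ℝ (Fin n))} {k : Fin n} {u g : EuclideanSpace ℝ (Fin n) → ℝ}
    (hg : IsWeakPartialDeriv V k u g) {x₀ : EuclideanSpace ℝ (Fin n)} {R M : ℝ}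
    (hRV : Metric.closedBall x₀ R ⊆ V)
    (hM : ∀ᵐ y ∂(volume.restrict (Metric.ball x₀ R)), |g y| ≤ M)
    (hint : LocallyIntegrable ((Metric.closedBall x₀ R).indicator u) volume)
    (ρ : ContDiffBump (0 : EuclideanSpace ℝ (Fin n))) {x : EuclideanSpace ℝ (Fin n)}
    (hx : Metric.closedBall x ρ.rOut ⊆ Metric.ball x₀ R) :
    |fderiv ℝ ((Metric.closedBall x₀ R).indicator u
      ⋆[(ContinuousLinearMap.lsmul ℝ ℝ).flip, volume] ρ.normed volume) x
        (EuclideanSpace.single k 1)| ≤ M := by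
  set e : EuclideanSpace ℝ (Fin n) := EuclideanSpace.single k 1 with he
  set ψ : EuclideanSpace ℝ (Fin n) → ℝ := fun y => ρ.normed volume (x - y) with hψ
  have hρs : ContDiff ℝ ∞ (ρ.normed volume) := ρ.contDiff_normed
  have hρc : HasCompactSupport (ρ.normed volume) := ρ.hasCompactSupport_normed
  have hψs : ContDiff ℝ ∞ ψ := hρs.comp (contDiff_const.sub contDiff_id)
  have hψc : HasCompactSupport ψ := hρc.comp_homeomorph (Homeomorph.subLeft x)
  have hψK : tsupport ψ ⊆ Metric.ball x₀ R := by
    refine (closure_minimal (fun y hy => ?_) Metric.isClosed_closedBall).trans hx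
    have h : x - y ∈ Function.support (ρ.normed volume) := hy
    rw [ρ.support_normed_eq, Metric.mem_ball, dist_zero_right] at h
    rw [Metric.mem_closedBall, dist_comm, dist_eq_norm]
    exact h.le
  have hψB : tsupport ψ ⊆ Metric.closedBall x₀ R := hψK.trans Metric.ball_subset_closedBall
  have hψ0 : ∀ y, y ∉ tsupport ψ → ψ y = 0 := fun y hy => image_eq_zero_of_notMem_tsupport hy
  have hDψ0 : ∀ y, y ∉ tsupport ψ → fderiv ℝ ψ y = 0 := fun y hy =>
    Function.notMem_support.1 fun h => hy (support_fderiv_subset ℝ h)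
  have hDψ : ∀ y, fderiv ℝ ψ y e = -fderiv ℝ (ρ.normed volume) (x - y) e := fun y => by
    have h1 : HasFDerivAt (fun y => x - y)
        (-ContinuousLinearMap.id ℝ (EuclideanSpace ℝ (Fin n))) y := (hasFDerivAt_id y).const_sub x
    have h2 := ((hρs.differentiable (by simp)) (x - y)).hasFDerivAt.comp y h1
    rw [show ψ = ρ.normed volume ∘ fun y => x - y from rfl, HasFDerivAt.fderiv h2]
    simp
  have hder := hρc.hasFDerivAt_convolution_right (ContinuousLinearMap.lsmul ℝ ℝ).flip hint
    (hρs.of_le (by simp)) x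
  rw [hder.fderiv, convolution_precompR_apply _ hint (hρc.fderiv ℝ)
    (hρs.continuous_fderiv (by simp))]
  have h1 : ((Metric.closedBall x₀ R).indicator u
      ⋆[(ContinuousLinearMap.lsmul ℝ ℝ).flip, volume]
        fun a => fderiv ℝ (ρ.normed volume) a e) x =
      -∫ y in V, u y * fderiv ℝ ψ y e := by
    rw [setIntegral_eq_integral_of_forall_compl_eq_zero fun y hy => by
      simp [hDψ0 y fun h => hy (hRV (hψB h))], ← integral_neg]
    refine integral_congr_ae (Filter.Eventually.of_forall fun y => ?_)
    simp only [ContinuousLinearMap.flip_apply, ContinuousLinearMap.lsmul_apply, smul_eq_mul]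
    by_cases hy : y ∈ tsupport ψ
    · rw [Set.indicator_of_mem (hψB hy), hDψ]
      ring
    · have h := hDψ y
      rw [hDψ0 y hy, zero_apply] at h
      rw [neg_eq_zero.1 h.symm, hDψ0 y hy]
      simp
  have hψnn : ∀ y, 0 ≤ ψ y := fun y => ρ.nonneg_normed _
  have hψi : Integrable ψ volume := hψs.continuous.integrable_of_hasCompactSupport hψc
  have hψ1 : ∫ y, ψ y = 1 := by
    rw [hψ, integral_sub_left_eq_self (ρ.normed volume) volume x, ρ.integral_normed]
  have hK : ∀ f : EuclideanSpace ℝ (Fin n) → ℝ,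
      ∫ y in Metric.ball x₀ R, f y * ψ y = ∫ y, f y * ψ y := fun f =>
    setIntegral_eq_integral_of_forall_compl_eq_zero fun y hy => by
      rw [hψ0 y fun h => hy (hψK h), mul_zero]
  rw [h1, hg.integral_eq ψ hψs hψc (hψB.trans hRV), neg_neg,
    setIntegral_eq_integral_of_forall_compl_eq_zero fun y hy => by
      rw [hψ0 y fun h => hy (hRV (hψB h)), mul_zero], ← hK, ← Real.norm_eq_abs]
  calc _ ≤ ∫ y in Metric.ball x₀ R, M * ψ y := by
        refine norm_integral_le_of_norm_le (hψi.const_mul M).integrableOn ?_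
        filter_upwards [hM] with y hy
        rw [norm_mul, Real.norm_eq_abs, Real.norm_eq_abs, abs_of_nonneg (hψnn y)]
        exact mul_le_mul_of_nonneg_right hy (hψnn y)
    _ = M := by rw [hK, integral_const_mul, hψ1, mul_one]

theorem opNorm_le_sum_of_abs_single_le {n : ℕ} (L : EuclideanSpace ℝ (Fin n) →L[ℝ] ℝ)
    {M : Fin n → ℝ} (hM : ∀ k, |L (EuclideanSpace.single k 1)| ≤ M k) : ‖L‖ ≤ ∑ k, M k := by
  have hM0 : ∀ k, 0 ≤ M k := fun k => (abs_nonneg _).trans (hM k)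
  refine L.opNorm_le_bound (Finset.sum_nonneg fun k _ => hM0 k) fun w => ?_
  have hw : w = ∑ k, w k • EuclideanSpace.single k (1 : ℝ) := by
    ext j
    simp [Pi.single_apply]
  have hLw : L w = ∑ k, w k * L (EuclideanSpace.single k 1) := by
    conv_lhs => rw [hw]
    simp
  rw [hLw, Finset.sum_mul]
  refine (norm_sum_le _ _).trans (Finset.sum_le_sum fun k _ => ?_)
  rw [norm_mul, mul_comm]
  exact mul_le_mul (hM k) (PiLp.norm_apply_le w k) (norm_nonneg _) (hM0 k)

-- On the half ball the mollifications are Lipschitz with the scale-independent constant `∑ k, M k`;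
-- they converge pointwise to the continuous `u`, which inherits the constant.
open scoped Convolution in
theorem locallyLipschitzOn_of_isWeakPartialDeriv {n : ℕ} {V : Set (EuclideanSpace ℝ (Fin n))}
    (hV : IsOpen V) {u : EuclideanSpace ℝ (Fin n) → ℝ} {g : Fin n → EuclideanSpace ℝ (Fin n) → ℝ}
    (hu : ContinuousOn u V) (hg : ∀ k, IsWeakPartialDeriv V k u (g k))
    (hgb : ∀ K : Set (EuclideanSpace ℝ (Fin n)), IsOpen K → IsCompact (closure K) →
      closure K ⊆ V → ∀ k, MemLp (g k) ∞ (volume.restrict K)) : LocallyLipschitzOn V u := by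
  intro x₀ hx₀
  obtain ⟨R, hR, hRV⟩ := Metric.nhds_basis_closedBall.mem_iff.1 (hV.mem_nhds hx₀)
  have hcb := isCompact_closedBall x₀ R
  have hcl : closure (Metric.ball x₀ R) ⊆ Metric.closedBall x₀ R :=
    Metric.closure_ball_subset_closedBall
  have hM : ∀ k, ∃ M, ∀ᵐ y ∂(volume.restrict (Metric.ball x₀ R)), |g k y| ≤ M := fun k => by
    have h := hgb _ Metric.isOpen_ball (hcb.of_isClosed_subset isClosed_closure hcl)
      (hcl.trans hRV) k
    refine ⟨(eLpNorm (g k) ∞ (volume.restrict (Metric.ball x₀ R))).toReal, ?_⟩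
    rw [eLpNorm_exponent_top]
    filter_upwards [ae_le_eLpNormEssSup (f := g k)
      (μ := volume.restrict (Metric.ball x₀ R))] with y hy
    rw [← Real.norm_eq_abs, ← toReal_enorm]
    refine ENNReal.toReal_mono ?_ hy
    have := h.2
    rw [eLpNorm_exponent_top] at this
    exact this.ne
  choose M hM using hM
  have hint : LocallyIntegrable ((Metric.closedBall x₀ R).indicator u) volume :=
    (((hu.mono hRV).integrableOn_compact hcb).integrable_indicator
      Metric.isClosed_closedBall.measurableSet).locallyIntegrable
  have happrox : ∀ y ∈ Metric.ball x₀ (R / 2), ∀ η > 0, ∃ δ > 0,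
      ∀ ρ : ContDiffBump (0 : EuclideanSpace ℝ (Fin n)), ρ.rOut ≤ δ →
        |((Metric.closedBall x₀ R).indicator u
          ⋆[(ContinuousLinearMap.lsmul ℝ ℝ).flip, volume] ρ.normed volume) y - u y| ≤ η := by
    intro y hy η hη
    have hyR : y ∈ Metric.ball x₀ R := Metric.ball_subset_ball (by linarith) hy
    have hyc : y ∈ Metric.closedBall x₀ R := Metric.ball_subset_closedBall hyR
    have hcont : ContinuousAt ((Metric.closedBall x₀ R).indicator u) y :=
      (hu.continuousAt (hV.mem_nhds (hRV hyc))).congr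
        (Filter.mem_of_superset (Metric.isOpen_ball.mem_nhds hyR) fun z hz =>
          (Set.indicator_of_mem (Metric.ball_subset_closedBall hz) u).symm)
    obtain ⟨δ, hδ, h⟩ := Metric.continuousAt_iff.1 hcont η hη
    refine ⟨δ, hδ, fun ρ hρ => ?_⟩
    have := ρ.dist_normed_convolution_le (μ := volume) (x₀ := y) (ε := η)
      hint.aestronglyMeasurable fun z hz => (h (Metric.ball_subset_ball hρ hz)).le
    rwa [← convolution_flip, Set.indicator_of_mem hyc, Real.dist_eq] at this
  -- The ball has positive measure, so each almost-everywhere bound holds at some point.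
  have hM0 : 0 ≤ ∑ k, M k := by
    refine Finset.sum_nonneg fun k _ => ?_
    have : (volume.restrict (Metric.ball x₀ R)) ≠ 0 := by
      rw [Ne, Measure.restrict_eq_zero]
      exact (Metric.measure_ball_pos volume x₀ hR).ne'
    have : NeZero (volume.restrict (Metric.ball x₀ R)) := ⟨this⟩
    obtain ⟨y, hy⟩ := (hM k).exists
    exact (abs_nonneg _).trans hy
  refine ⟨⟨∑ k, M k, hM0⟩, Metric.ball x₀ (R / 2),
    mem_nhdsWithin_of_mem_nhds (Metric.ball_mem_nhds x₀ (by linarith)),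
    LipschitzOnWith.of_dist_le_mul fun y hy z hz => ?_⟩
  refine le_of_forall_pos_le_add fun η hη => ?_
  obtain ⟨δ₁, hδ₁, h₁⟩ := happrox y hy (η / 2) (by linarith)
  obtain ⟨δ₂, hδ₂, h₂⟩ := happrox z hz (η / 2) (by linarith)
  obtain ⟨ε, hε, hε'⟩ : ∃ ε > 0, ε ≤ min (min δ₁ δ₂) (R / 2) :=
    ⟨min (min δ₁ δ₂) (R / 2), lt_min (lt_min hδ₁ hδ₂) (by linarith), le_rfl⟩
  -- The bound `ε ≤ R / 2` keeps bumps centred in the half ball inside the full ball.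
  obtain ⟨⟨hε₁, hε₂⟩, hε₃⟩ : (ε ≤ δ₁ ∧ ε ≤ δ₂) ∧ ε ≤ R / 2 := by simpa using hε'
  let ρ : ContDiffBump (0 : EuclideanSpace ℝ (Fin n)) := ⟨ε / 2, ε, half_pos hε, half_lt_self hε⟩
  specialize h₁ ρ hε₁
  specialize h₂ ρ hε₂
  set v := (Metric.closedBall x₀ R).indicator u
    ⋆[(ContinuousLinearMap.lsmul ℝ ℝ).flip, volume] ρ.normed volume with hv
  have hvd : ∀ x ∈ Metric.ball x₀ (R / 2), DifferentiableAt ℝ v x := fun x _ =>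
    (ρ.hasCompactSupport_normed.hasFDerivAt_convolution_right
      (ContinuousLinearMap.lsmul ℝ ℝ).flip hint ρ.contDiff_normed x).differentiableAt
  have hvb : ∀ x ∈ Metric.ball x₀ (R / 2), ‖fderiv ℝ v x‖ ≤ ∑ k, M k := fun x hx =>
    opNorm_le_sum_of_abs_single_le _ fun k =>
      (hg k).abs_fderiv_mollification_le hRV (hM k) hint ρ fun w hw => by
        rw [Metric.mem_ball] at hx ⊢
        have h3 : dist w x ≤ ε := hw
        linarith [dist_triangle w x x₀]
  have h3 := (convex_ball x₀ (R / 2)).norm_image_sub_le_of_norm_fderiv_le hvd hvb hz hy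
  rw [Real.norm_eq_abs] at h3
  rw [Real.dist_eq, dist_eq_norm]
  change |u y - u z| ≤ (∑ k, M k) * ‖y - z‖ + η
  rw [abs_le] at *
  constructor <;> linarith [h₁.1, h₁.2, h₂.1, h₂.2, h3.1, h3.2]

/-! ### Local Lipschitz continuity of matrix powers. -/

theorem locallyLipschitzOn_matPow {E : Type*} [MetricSpace E] [ProperSpace E] {d : ℕ}
    {V : Set E} (hV : IsOpen V) {A : E → Matrix (Fin d) (Fin d) ℝ} (hpd : ∀ x ∈ V, (A x).PosDef)
    (hA : ∀ i j, LocallyLipschitzOn V (fun x => A x i j)) (α : ℝ) (i j : Fin d) :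
    LocallyLipschitzOn V (fun x => matPow (A x) α i j) := by
  intro x₀ hx₀
  obtain ⟨r, hr, hc, hsub⟩ := exists_ball_closure_subset hV hx₀
  set K := closure (Metric.ball x₀ r)
  have hcont : ContinuousOn A K :=
    continuousOn_pi.2 fun i => continuousOn_pi.2 fun j => (hA i j).continuousOn.mono hsub
  have hinv : ContinuousOn (fun x => (A x)⁻¹) K := by
    simp only [Matrix.inv_def, Ring.inverse_eq_inv']
    have hdet : ContinuousOn (fun x => (A x).det) K :=
      (continuous_id.matrix_det).comp_continuousOn hcont
    exact (hdet.inv₀ fun x hx => (hpd x (hsub hx)).det_pos.ne').smul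
      ((continuous_id.matrix_adjugate).comp_continuousOn hcont)
  obtain ⟨C₁, hC₁⟩ := hc.exists_bound_of_continuousOn
    ((continuous_id.matrix_trace).comp_continuousOn hcont)
  obtain ⟨C₂, hC₂⟩ := hc.exists_bound_of_continuousOn
    ((continuous_id.matrix_trace).comp_continuousOn hinv)
  -- Taking `max C₂ 1` makes the left endpoint positive whatever the sign of `C₂`, which puts the
  -- interval where `t ^ α` is Lipschitz.
  have hspec : ∀ x (hx : x ∈ K) i, (hpd x (hsub hx)).isHermitian.eigenvalues i ∈
      Set.Icc (max C₂ 1)⁻¹ C₁ := fun x hx i => by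
    have hp := hpd x (hsub hx)
    refine ⟨inv_le_of_inv_le₀ (hp.eigenvalues_pos i) ?_, ?_⟩
    · exact (hp.inv_eigenvalues_le_trace_inv i).trans
        ((le_abs_self _).trans ((hC₂ x hx).trans (le_max_left _ _)))
    · exact (hp.eigenvalues_le_trace i).trans ((le_abs_self _).trans (hC₁ x hx))
  obtain ⟨L, hL⟩ := exists_lipschitzOnWith_rpow (a := (max C₂ 1)⁻¹) (b := C₁) (by positivity) α
  choose D hD using fun i j => ((hA i j).mono hsub).exists_lipschitzOnWith_of_compact hc
  refine ⟨L * NNReal.sqrt (∑ i, ∑ j, D i j ^ 2), Metric.ball x₀ r,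
    mem_nhdsWithin_of_mem_nhds (Metric.ball_mem_nhds x₀ hr),
    LipschitzOnWith.mono (LipschitzOnWith.of_dist_le_mul fun x hx y hy => ?_) subset_closure⟩
  have h := sum_cfc_sub_sq_le (hpd x (hsub hx)).isHermitian (hpd y (hsub hy)).isHermitian
    (hspec x hx) (hspec y hy) hL
  refine abs_le_of_sq_le_sq ?_ (by positivity)
  calc (matPow (A x) α i j - matPow (A y) α i j) ^ 2
      ≤ ∑ i, ∑ j, (matPow (A x) α i j - matPow (A y) α i j) ^ 2 := by
        refine le_trans ?_ (Finset.single_le_sum (f := fun i => ∑ j,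
          (matPow (A x) α i j - matPow (A y) α i j) ^ 2)
          (fun i _ => Finset.sum_nonneg fun j _ => sq_nonneg _) (Finset.mem_univ i))
        exact Finset.single_le_sum (f := fun j =>
          (matPow (A x) α i j - matPow (A y) α i j) ^ 2)
          (fun j _ => sq_nonneg _) (Finset.mem_univ j)
    _ ≤ L ^ 2 * ∑ i, ∑ j, (A x i j - A y i j) ^ 2 := h
    _ ≤ L ^ 2 * ∑ i, ∑ j, (D i j * dist x y) ^ 2 := by
        gcongr L ^ 2 * ∑ i, ∑ j, ?_ with i _ j _
        rw [sq_le_sq, abs_of_nonneg (by positivity : 0 ≤ (D i j : ℝ) * dist x y), ← Real.dist_eq]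
        exact (hD i j).dist_le_mul x hx y hy
    _ = ((L * NNReal.sqrt (∑ i, ∑ j, D i j ^ 2) : NNReal) * dist x y) ^ 2 := by
        have hs : ((NNReal.sqrt (∑ i, ∑ j, D i j ^ 2) : NNReal) : ℝ) ^ 2 =
            ∑ i, ∑ j, (D i j : ℝ) ^ 2 := by
          rw [← NNReal.coe_pow, NNReal.sq_sqrt]
          push_cast
          rfl
        rw [NNReal.coe_mul, mul_pow, mul_pow, hs, mul_assoc, Finset.sum_mul]
        simp only [mul_pow, Finset.sum_mul]

/-! ### The Sobolev class as locally Lipschitz maps, and passage to the limit. -/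

theorem MemW1InftyLocPD.locallyLipschitzOn {n d : ℕ} {V : Set (EuclideanSpace ℝ (Fin n))}
    (hV : IsOpen V) {A : EuclideanSpace ℝ (Fin n) → Matrix (Fin d) (Fin d) ℝ}
    (hA : MemW1InftyLocPD V A) (i j : Fin d) : LocallyLipschitzOn V (fun x => A x i j) := by
  obtain ⟨G, hG, hb⟩ := hA.exists_weakGradient
  exact locallyLipschitzOn_of_isWeakPartialDeriv hV
    (continuousOn_pi.1 (continuousOn_pi.1 hA.continuousOn i) j) (fun k => hG k i j)
    fun K hK hKc hKV k => (hb K hK hKc hKV).2 k i j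

theorem memW1InftyLocPD_of_locallyLipschitzOn {n d : ℕ} {V : Set (EuclideanSpace ℝ (Fin n))}
    (hV : IsOpen V) {A : EuclideanSpace ℝ (Fin n) → Matrix (Fin d) (Fin d) ℝ}
    (hpd : ∀ x ∈ V, (A x).PosDef) (hA : ∀ i j, LocallyLipschitzOn V (fun x => A x i j)) :
    MemW1InftyLocPD V A where
  continuousOn := continuousOn_pi.2 fun i => continuousOn_pi.2 fun j => (hA i j).continuousOn
  posDef := hpd
  exists_weakGradient :=
    ⟨fun x k i j => lineDeriv ℝ (fun y => A y i j) x (EuclideanSpace.single k 1),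
      fun k i j => (hA i j).isWeakPartialDeriv_lineDeriv hV k, fun _ hK hKc hKV =>
      ⟨fun i j => (hA i j).continuousOn.memLp_top_of_isCompact_closure hK hKc hKV,
        fun _ i j => (hA i j).memLp_top_lineDeriv hK hKc hKV _⟩⟩

/-- By uniqueness, any representative `G` agrees almost everywhere with the classical line
derivatives, which exist almost everywhere by Rademacher's argument. -/
theorem IsWeakGradient.ae_hasLineDerivAt {n d : ℕ} {V : Set (EuclideanSpace ℝ (Fin n))}
    (hV : IsOpen V) {A : EuclideanSpace ℝ (Fin n) → Matrix (Fin d) (Fin d) ℝ}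
    {G : EuclideanSpace ℝ (Fin n) → Fin n → Matrix (Fin d) (Fin d) ℝ}
    (hG : IsWeakGradient V A G) (hA : ∀ i j, LocallyLipschitzOn V (fun x => A x i j)) :
    ∀ᵐ x, x ∈ V → ∀ k i j,
      HasLineDerivAt ℝ (fun y => A y i j) (G x k i j) x (EuclideanSpace.single k 1) := by
  have h : ∀ k i j, ∀ᵐ x, x ∈ V →
      HasLineDerivAt ℝ (fun y => A y i j) (G x k i j) x (EuclideanSpace.single k 1) := by
    intro k i j
    filter_upwards [(hG k i j).ae_eq hV ((hA i j).isWeakPartialDeriv_lineDeriv hV k),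
      (hA i j).ae_lineDifferentiableAt (μ := volume) hV (EuclideanSpace.single k 1)] with x h1 h2 hx
    rw [h1 hx]
    exact (h2 hx).hasLineDerivAt
  filter_upwards [ae_all_iff.2 fun k => ae_all_iff.2 fun i => ae_all_iff.2 fun j => h k i j]
    with x hx hxV k i j using hx k i j hxV

theorem theorem4p1 {n d : ℕ} (V : Set (EuclideanSpace ℝ (Fin n))) (hV : IsOpen V)
    (A : EuclideanSpace ℝ (Fin n) → Matrix (Fin d) (Fin d) ℝ) (hA : MemW1InftyLocPD V A)
    (α β : ℝ) :
    (MemW1InftyLocPD V (fun x => matPow (A x) α) ∧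
      MemW1InftyLocPD V (fun x => matPow (A x) β) ∧
      MemW1InftyLocPD V (fun x => matPow (A x) ((α + β) / 2))) ∧
    ∀ Gα Gβ Gm : EuclideanSpace ℝ (Fin n) → Fin n → Matrix (Fin d) (Fin d) ℝ,
      IsWeakGradient V (fun x => matPow (A x) α) Gα →
      IsWeakGradient V (fun x => matPow (A x) β) Gβ →
      IsWeakGradient V (fun x => matPow (A x) ((α + β) / 2)) Gm →
      ∀ᵐ x ∂(volume.restrict V), tensorInner (Gα x) (Gβ x) ≤ tensorNorm (Gm x) ^ 2 := by
  have hlip : ∀ γ i j, LocallyLipschitzOn V (fun x => matPow (A x) γ i j) := fun γ =>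
    locallyLipschitzOn_matPow hV hA.posDef (hA.locallyLipschitzOn hV) γ
  have hmem : ∀ γ, MemW1InftyLocPD V (fun x => matPow (A x) γ) := fun γ =>
    memW1InftyLocPD_of_locallyLipschitzOn hV (fun x hx => matPow_posDef (hA.posDef x hx) γ) (hlip γ)
  refine ⟨⟨hmem _, hmem _, hmem _⟩, fun Gα Gβ Gm hα hβ hm => ?_⟩
  rw [ae_restrict_iff' hV.measurableSet]
  filter_upwards [hα.ae_hasLineDerivAt hV (hlip _), hβ.ae_hasLineDerivAt hV (hlip _),
    hm.ae_hasLineDerivAt hV (hlip _)] with x dα dβ dm hx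
  have hnn : 0 ≤ tensorInner (Gm x) (Gm x) := Finset.sum_nonneg fun k _ =>
    Finset.sum_nonneg fun i _ => Finset.sum_nonneg fun j _ => mul_self_nonneg _
  rw [tensorNorm, Real.sq_sqrt hnn]
  refine Finset.sum_le_sum fun k _ => ?_
  -- For each direction `k`, both sides are limits of sums of products of difference quotients as `t
  -- → 0⁺`.
  refine le_of_tendsto_of_tendsto
    (tendsto_finsetSum _ fun i _ => tendsto_finsetSum _ fun j _ =>
      (dα hx k i j).tendsto_slope_zero_right.mul (dβ hx k i j).tendsto_slope_zero_right)
    (tendsto_finsetSum _ fun i _ => tendsto_finsetSum _ fun j _ =>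
      (dm hx k i j).tendsto_slope_zero_right.mul (dm hx k i j).tendsto_slope_zero_right) ?_
  have hnear : ∀ᶠ t : ℝ in nhdsWithin 0 (Set.Ioi 0), x + t • EuclideanSpace.single k 1 ∈ V := by
    have hc : ContinuousAt (fun t : ℝ => x + t • EuclideanSpace.single k (1 : ℝ)) 0 := by fun_prop
    exact mem_nhdsWithin_of_mem_nhds (hc (hV.mem_nhds (by simpa using hx)))
  filter_upwards [hnear] with t ht
  have h := sum_matPow_sub_mul_le (hA.posDef _ ht) (hA.posDef x hx) α β
  -- The factor `t⁻¹ ^ 2` supplies one `t⁻¹` to each difference in a product.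
  have h' := mul_le_mul_of_nonneg_left h (sq_nonneg t⁻¹)
  simp only [Finset.mul_sum] at h'
  refine (Eq.le ?_).trans (h'.trans (Eq.le ?_)) <;>
    refine Finset.sum_congr rfl fun i _ => Finset.sum_congr rfl fun j _ => ?_ <;>
    simp only [smul_eq_mul] <;> ring
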